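/- **Conventions.** Let $L$ be a finite-dimensional real Lie algebra. A connection on $L$ is a linear map $D:L\to\operatorname{End}(L)$, $X\mapsto D_X$; it is flat if $D_{[X,Y]}=D_XD_Y-D_YD_X$. A hyper-Hermitian structure $(\{J_\alpha\}_{\alpha=1,2,3},g)$ on $L$ consists of integrable complex structures with $J_\alpha^2=-\mathrm{id}$, $J_1J_2=-J_2J_1=J_3$, and an inner product $g$ with $g(J_\alpha X,J_\alpha Y)=g(X,Y)$. A connection $D$ is hyper-Hermitian if $Dg=0$ and $DJ_\alpha=0$ for all $\alpha$. The structure is strong HKT if there is a hyper-Hermitian connection $\nabla$ with torsion $T$ such that $c(X,Y,Z)=g(X,T(Y,Z))$ is a closed $3$-form, closedness being with respect to the Chevalley–Eilenberg (left-invariant exterior) differential. If $D$ is flat, the tangent algebra $T_DL=L\ltimes_D L$ is $L\times L$ with bracket $$[(X_1,X_2),(Y_1,Y_2)]=([X_1,Y_1],\,D_{X_1}Y_2-D_{Y_1}X_2),$$ and the induced structure on it is $\tilde J_\alpha(X_1,X_2)=(J_\alpha X_1,J_\alpha X_2)$, $\tilde g((X_1,X_2),(Y_1,Y_2))=g(X_1,Y_1)+g(X_2,Y_2)$.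 Let $\mathfrak{sp}(q)$ be the Lie algebra of skew-Hermitian quaternionic $q\times q$ matrices, and let $l\,\mathfrak u(1)=\mathbb R^l$ be abelian with standard basis $e_1,\dots,e_l$. The Joyce hypercomplex structure on $\mathfrak{sp}(l)\oplus l\,\mathfrak u(1)$ is defined as follows, with $(i_1,i_2,i_3)=(i,j,k)$ and $E_{ab}$ the matrix units. On $\mathbb R e_a\oplus \operatorname{Im}(\mathbb H)E_{aa}\cong\mathbb R\oplus\operatorname{Im}\mathbb H=\mathbb H$, $J_\alpha$ is left multiplication by $i_\alpha$. For $a<b$ and $v\in\mathbb H$, $J_\alpha(vE_{ab}-\bar vE_{ba})=(i_\alpha v)E_{ab}-\overline{(i_\alpha v)}E_{ba}$. For $r>0$ let $$g_r\big((X,t),(Y,s)\big)=r\Big(-\operatorname{Re}\operatorname{tr}(XY)+\sum_a t_as_a\Big),$$ whose restriction to $\mathfrak{sp}(l)$ is a positive multiple of the opposite of the Killing form. **Proposition 5.1.** Let $l\ge1$, $r>0$ and $n=l(l+1)/2$. Then $(\{J_\alpha\},g_r)$ is a strong HKT structure on $\mathfrak{sp}(l)\oplus l\,\mathfrak u(1)$.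 There is an injective Lie algebra homomorphism $\mathfrak{sp}(l)\hookrightarrow\mathfrak{sp}(n)$, and for every such injective homomorphism $\iota$ there is a nonzero flat hyper-Hermitian connection $D$ on $\mathfrak{sp}(l)\oplus l\,\mathfrak u(1)$ that is induced by $\iota$: for some real linear isometry $\Phi$ from $(\mathfrak{sp}(l)\oplus l\,\mathfrak u(1),g_r)$ onto $\mathbb H^{n}$ (row vectors, with inner product $\operatorname{Re}\sum_a v_a\bar w_a$) carrying $J_\alpha$ to left multiplication by $i_\alpha$, $$\Phi(D_{(X,t)}Y)=\Phi(Y)\,\iota(X)^*\qquad\text{for all }(X,t),\,Y\in\mathfrak{sp}(l)\oplus l\,\mathfrak u(1).$$ Moreover, the induced structure $(\{\tilde J_\alpha\},\tilde g_r)$ on $T_D(\mathfrak{sp}(l)\oplus l\,\mathfrak u(1))$ is strong HKT. -/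

import Mathlib

open scoped Matrix

attribute [local instance 100] LieRing.ofAssociativeRing

noncomputable section

namespace HKT

/-! ### Hyper-Hermitian and (strong) HKT structures on a real Lie algebra

Tensors and connections on a Lie algebra stand for left-invariant ones on a Lie group. -/

section General

variable {L : Type*} [LieRing L] [LieAlgebra ℝ L]

/-- A (left-invariant) connection `D` on `L`: `D X Y` is the covariant derivative `D_X Y`. -/
abbrev Connection (L : Type*) [LieRing L] [LieAlgebra ℝ L] : Type _ :=
  L →ₗ[ℝ] Module.End ℝ L

/-- The curvature `R(X, Y) = D_X D_Y - D_Y D_X - D_[X,Y]`. -/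
def curvature (D : Connection L) (X Y : L) : Module.End ℝ L :=
  D X * D Y - D Y * D X - D ⁅X, Y⁆

/-- The torsion `T(X, Y) = D_X Y - D_Y X - [X, Y]`. -/
def torsion (D : Connection L) (X Y : L) : L :=
  D X Y - D Y X - ⁅X, Y⁆

/-- A connection is flat if its curvature vanishes. -/
def IsFlat (D : Connection L) : Prop :=
  ∀ X Y : L, curvature D X Y = 0

/-- The Nijenhuis tensor `N(X, Y) = J([X, Y] - [JX, JY]) - ([JX, Y] + [X, JY])`. -/
def nijenhuis (J : Module.End ℝ L) (X Y : L) : L :=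
  J (⁅X, Y⁆ - ⁅J X, J Y⁆) - (⁅J X, Y⁆ + ⁅X, J Y⁆)

/-- A hypercomplex structure: integrable `J 0, J 1, J 2` (written `J_1, J_2, J_3`) with
`J_α² = -1` and `J_1 J_2 = -J_2 J_1 = J_3`. -/
structure IsHypercomplex (J : Fin 3 → Module.End ℝ L) : Prop where
  sq : ∀ α, J α * J α = -1
  mul_eq : J 0 * J 1 = J 2
  anticomm : J 0 * J 1 = -(J 1 * J 0)
  integrable : ∀ α X Y, nijenhuis (J α) X Y = 0

/-- A hyper-Hermitian structure: a hypercomplex structure with a compatible inner product. -/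
structure IsHyperHermitian (J : Fin 3 → Module.End ℝ L) (g : LinearMap.BilinForm ℝ L) :
    Prop where
  hypercomplex : IsHypercomplex J
  symm : ∀ X Y, g X Y = g Y X
  pos : ∀ X, X ≠ 0 → 0 < g X X
  compatible : ∀ α X Y, g (J α X) (J α Y) = g X Y

/-- A hyper-Hermitian connection: `D g = 0` and `D J_α = 0` for all `α`. -/
structure IsHyperHermitianConnection (J : Fin 3 → Module.End ℝ L)
    (g : LinearMap.BilinForm ℝ L) (D : Connection L) : Prop where
  metric : ∀ X Y Z, g (D X Y) Z + g Y (D X Z) = 0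
  parallel : ∀ α X Y, D X (J α Y) = J α (D X Y)

/-- The torsion tensor `c(X, Y, Z) = g(X, T(Y, Z))`. -/
def torsionTensor (g : LinearMap.BilinForm ℝ L) (D : Connection L) (X Y Z : L) : ℝ :=
  g X (torsion D Y Z)

/-- A trilinear expression is a `3`-form if it is totally skew-symmetric (the two
transpositions generate all permutations). -/
def IsTotallySkew (c : L → L → L → ℝ) : Prop :=
  (∀ X Y Z, c X Y Z = -c Y X Z) ∧ (∀ X Y Z, c X Y Z = -c X Z Y)

/-- The exterior derivative of a (left-invariant) `3`-form:
`dc(X_1, …, X_4) = ∑_{i<j} (-1)^{i+j} c([X_i, X_j], …)`. -/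
def extDeriv3 (c : L → L → L → ℝ) (X Y Z W : L) : ℝ :=
  -c ⁅X, Y⁆ Z W + c ⁅X, Z⁆ Y W - c ⁅X, W⁆ Y Z
    - c ⁅Y, Z⁆ X W + c ⁅Y, W⁆ X Z - c ⁅Z, W⁆ X Y

/-- A strong HKT structure: a hyper-Hermitian structure for which there is a hyper-Hermitian
connection whose torsion tensor is a closed `3`-form. (A hyper-Hermitian connection with totally
skew-symmetric torsion is unique: it is the common Bismut connection of the `(J_α, g)`.) -/
def IsStrongHKT (J : Fin 3 → Module.End ℝ L) (g : LinearMap.BilinForm ℝ L) : Prop :=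
  IsHyperHermitian J g ∧
    ∃ B : Connection L, IsHyperHermitianConnection J g B ∧
      IsTotallySkew (torsionTensor g B) ∧
      ∀ X Y Z W, extDeriv3 (torsionTensor g B) X Y Z W = 0

/-! ### The tangent Lie algebra `T_D L = L ⋉_D L` of a flat connection -/

/-- The underlying space `L × L` of the tangent Lie algebra of a flat connection `D`. -/
def TangentAlgebra (D : Connection L) (_hD : IsFlat D) : Type _ := L × L

namespace TangentAlgebra

variable (D : Connection L) (hD : IsFlat D)

instance : AddCommGroup (TangentAlgebra D hD) := inferInstanceAs (AddCommGroup (L × L))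

instance : Module ℝ (TangentAlgebra D hD) := inferInstanceAs (Module ℝ (L × L))

/-- `[(X_1, X_2), (Y_1, Y_2)] = ([X_1, Y_1], D_{X_1} Y_2 - D_{Y_1} X_2)`. -/
instance : Bracket (TangentAlgebra D hD) (TangentAlgebra D hD) where
  bracket x y := ((⁅x.1, y.1⁆, D x.1 y.2 - D y.1 x.2) : L × L)

theorem bracket_def (x y : TangentAlgebra D hD) :
    ⁅x, y⁆ = ((⁅x.1, y.1⁆, D x.1 y.2 - D y.1 x.2) : L × L) := rfl

theorem flat_apply {D : Connection L} (hD : IsFlat D) (X Y Z : L) :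
    D ⁅X, Y⁆ Z = D X (D Y Z) - D Y (D X Z) := by
  have h := LinearMap.congr_fun (hD X Y) Z
  simp only [curvature, LinearMap.sub_apply, Module.End.mul_apply, LinearMap.zero_apply] at h
  exact (sub_eq_zero.mp h).symm

instance : LieRing (TangentAlgebra D hD) where
  add_lie x y z := by
    refine Prod.ext (add_lie x.1 y.1 z.1) ?_
    change D (x.1 + y.1) z.2 - D z.1 (x.2 + y.2) =
      (D x.1 z.2 - D z.1 x.2) + (D y.1 z.2 - D z.1 y.2)
    simp only [map_add, LinearMap.add_apply]
    abel
  lie_add x y z := by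
    refine Prod.ext (lie_add x.1 y.1 z.1) ?_
    change D x.1 (y.2 + z.2) - D (y.1 + z.1) x.2 =
      (D x.1 y.2 - D y.1 x.2) + (D x.1 z.2 - D z.1 x.2)
    simp only [map_add, LinearMap.add_apply]
    abel
  lie_self x := Prod.ext (lie_self x.1) (sub_self (D x.1 x.2))
  leibniz_lie x y z := by
    refine Prod.ext (leibniz_lie x.1 y.1 z.1) ?_
    change D x.1 (D y.1 z.2 - D z.1 y.2) - D ⁅y.1, z.1⁆ x.2 =
      (D ⁅x.1, y.1⁆ z.2 - D z.1 (D x.1 y.2 - D y.1 x.2)) +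
        (D y.1 (D x.1 z.2 - D z.1 x.2) - D ⁅x.1, z.1⁆ y.2)
    simp only [flat_apply hD, map_sub]
    abel

instance : LieAlgebra ℝ (TangentAlgebra D hD) where
  lie_smul t x y := by
    refine Prod.ext (lie_smul t x.1 y.1) ?_
    change D x.1 (t • y.2) - D (t • y.1) x.2 = t • (D x.1 y.2 - D y.1 x.2)
    simp only [map_smul, LinearMap.smul_apply, smul_sub]

/-- `J̃_α (X_1, X_2) = (J_α X_1, J_α X_2)`. -/
def J (J : Fin 3 → Module.End ℝ L) : Fin 3 → Module.End ℝ (TangentAlgebra D hD) :=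
  fun α => ((J α).prodMap (J α) : L × L →ₗ[ℝ] L × L)

/-- `g̃ ((X_1, X_2), (Y_1, Y_2)) = g(X_1, Y_1) + g(X_2, Y_2)`. -/
def metric (g : LinearMap.BilinForm ℝ L) : LinearMap.BilinForm ℝ (TangentAlgebra D hD) :=
  (g.compl₁₂ (LinearMap.fst ℝ L L) (LinearMap.fst ℝ L L) +
    g.compl₁₂ (LinearMap.snd ℝ L L) (LinearMap.snd ℝ L L) : LinearMap.BilinForm ℝ (L × L))

end TangentAlgebra

end General

/-! ### The Lie algebra `sp(l) ⊕ l u(1)` -/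

/-- The compact symplectic Lie algebra `sp(q)`: skew-Hermitian `q × q` quaternionic matrices. -/
def sp (q : ℕ) : LieSubalgebra ℝ (Matrix (Fin q) (Fin q) (Quaternion ℝ)) where
  carrier := {A | Aᴴ = -A}
  add_mem' {A B} hA hB := by
    simp only [Set.mem_ofPred_eq] at *
    rw [Matrix.conjTranspose_add, hA, hB, neg_add]
  zero_mem' := by simp
  smul_mem' t A hA := by
    simp only [Set.mem_ofPred_eq] at *
    ext1 a b
    have h := congrFun (congrFun hA a) b
    simp only [Matrix.conjTranspose_apply, Matrix.neg_apply] at h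
    simp only [Matrix.conjTranspose_apply, Matrix.neg_apply, Matrix.smul_apply]
    rw [Quaternion.star_smul, h, smul_neg]
  lie_mem' {A B} hA hB := by
    simp only [Set.mem_ofPred_eq] at *
    rw [Ring.lie_def, Matrix.conjTranspose_sub, Matrix.conjTranspose_mul,
      Matrix.conjTranspose_mul, hA, hB]
    simp

theorem sp_apply {q : ℕ} (X : sp q) (a b : Fin q) : star (X.1 b a) = -X.1 a b := by
  have h := congrFun (congrFun X.2 a) b
  simpa [Matrix.conjTranspose_apply] using h

/-- `sp(l) ⊕ l u(1)`, with `l u(1)` the abelian Lie algebra `ℝ^l`. -/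
abbrev SpU (l : ℕ) : Type := sp l × (Fin l → ℝ)

/-- The quaternion units `i, j, k`. -/
def unit : Fin 3 → Quaternion ℝ :=
  ![⟨0, 1, 0, 0⟩, ⟨0, 0, 1, 0⟩, ⟨0, 0, 0, 1⟩]

/-- The matrix part of Joyce's endomorphism attached to a quaternion `p`; see `joyceEnd`. -/
def joyceMatrix {l : ℕ} (p : Quaternion ℝ) (X : SpU l) :
    Matrix (Fin l) (Fin l) (Quaternion ℝ) :=
  fun a b =>
    if a < b then p * X.1.1 a b
    else if b < a then -star (p * X.1.1 b a)
    else (p * (X.1.1 a a + (X.2 a : Quaternion ℝ))).im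

theorem joyceMatrix_mem {l : ℕ} (p : Quaternion ℝ) (X : SpU l) : joyceMatrix p X ∈ sp l := by
  change (joyceMatrix p X)ᴴ = -joyceMatrix p X
  ext1 a b
  rw [Matrix.conjTranspose_apply, Matrix.neg_apply]
  unfold joyceMatrix
  rcases lt_trichotomy a b with h | h | h
  · simp [h, h.not_gt]
  · subst h
    simp
  · simp [h, h.not_gt]

/-- Joyce's endomorphism of `sp(l) ⊕ l u(1)` attached to a quaternion `p`.

With `E_ab` the matrix units and `e_1, …, e_l` the standard basis of `l u(1) = ℝ^l`, Joyce's
decomposition is `sp(l) ⊕ l u(1) = ⨁_a (ℝ e_a ⊕ d_a) ⊕ ⨁_a f_a`, where `d_a = Im(ℍ) E_aa ≅ sp(1)`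
and `f_a = ⨁_{b > a} {v E_ab - v̄ E_ba : v ∈ ℍ}`. On `ℝ e_a ⊕ d_a ≅ ℝ ⊕ Im ℍ = ℍ` the
endomorphism is left multiplication by `p`; on `f_a` it is `v E_ab - v̄ E_ba ↦ p v E_ab - (p v)‾ E_ba`,
which for imaginary `p` is `ad (p E_aa)`. -/
def joyceEnd (l : ℕ) (p : Quaternion ℝ) : Module.End ℝ (SpU l) where
  toFun X := (⟨joyceMatrix p X, joyceMatrix_mem p X⟩,
    fun a => (p * (X.1.1 a a + (X.2 a : Quaternion ℝ))).re)
  map_add' X Y := by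
    have h (a : Fin l) : p * ((X + Y).1.1 a a + ((X + Y).2 a : Quaternion ℝ)) =
        p * (X.1.1 a a + (X.2 a : Quaternion ℝ)) + p * (Y.1.1 a a + (Y.2 a : Quaternion ℝ)) := by
      change p * ((X.1.1 a a + Y.1.1 a a) + ((X.2 a + Y.2 a : ℝ) : Quaternion ℝ)) = _
      rw [Quaternion.coe_add, ← mul_add, add_add_add_comm]
    have h' (a b : Fin l) : p * (X + Y).1.1 a b = p * X.1.1 a b + p * Y.1.1 a b :=
      mul_add p (X.1.1 a b) (Y.1.1 a b)
    refine Prod.ext (Subtype.ext ?_) ?_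
    · ext1 a b
      change joyceMatrix p (X + Y) a b = joyceMatrix p X a b + joyceMatrix p Y a b
      unfold joyceMatrix
      rw [h, h', h']
      split_ifs
      · rfl
      · rw [star_add, neg_add]
      · rw [Quaternion.im_add]
    · funext a
      change (p * ((X + Y).1.1 a a + ((X + Y).2 a : Quaternion ℝ))).re = _
      rw [h]
      rfl
  map_smul' t X := by
    have h (a : Fin l) : p * ((t • X).1.1 a a + ((t • X).2 a : Quaternion ℝ)) =
        t • (p * (X.1.1 a a + (X.2 a : Quaternion ℝ))) := by
      change p * (t • X.1.1 a a + ((t * X.2 a : ℝ) : Quaternion ℝ)) = _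
      rw [← mul_smul_comm, smul_add, Quaternion.coe_mul, Quaternion.coe_mul_eq_smul]
    have h' (a b : Fin l) : p * (t • X).1.1 a b = t • (p * X.1.1 a b) :=
      mul_smul_comm t p (X.1.1 a b)
    refine Prod.ext (Subtype.ext ?_) ?_
    · ext1 a b
      change joyceMatrix p (t • X) a b = t • joyceMatrix p X a b
      unfold joyceMatrix
      rw [h, h', h']
      split_ifs
      · rfl
      · rw [Quaternion.star_smul, smul_neg]
      · rw [Quaternion.im_smul]
    · funext a
      change (p * ((t • X).1.1 a a + ((t • X).2 a : Quaternion ℝ))).re = _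
      rw [h]
      rfl

/-- Joyce's hypercomplex structure on `sp(l) ⊕ l u(1)`. -/
def joyceJ (l : ℕ) : Fin 3 → Module.End ℝ (SpU l) := fun α => joyceEnd l (unit α)

/-- The inner product `r (-Re tr(X Y) + ∑ t_a s_a)` on `sp(l) ⊕ l u(1)`. For `r > 0` its restriction
to `sp(l)` is a positive multiple of the opposite of the Killing form `4 (l + 1) Re tr(X Y)`. -/
def joyceMetric (l : ℕ) (r : ℝ) : LinearMap.BilinForm ℝ (SpU l) :=
  LinearMap.mk₂ ℝ (fun X Y => r * (-(Matrix.trace (X.1.1 * Y.1.1)).re + ∑ a, X.2 a * Y.2 a))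
    (fun X X' Y => by
      simp [add_mul, Finset.sum_add_distrib]; ring)
    (fun t X Y => by
      simp [mul_assoc, ← Finset.mul_sum]; ring)
    (fun X Y Y' => by
      simp [mul_add, Finset.sum_add_distrib]; ring)
    (fun t X Y => by
      simp [mul_left_comm _ t, ← Finset.mul_sum]; ring)

/-! ### Quaternionic unitary identification with `ℍ^q` -/

/-- `Φ` identifies `(L, J, g)` with `ℍ^q`, with left multiplication by `i, j, k` and the standard
inner product `Re ∑ v_a w̄_a`. -/
structure IsQuaternionicIsometry {L : Type*} [LieRing L] [LieAlgebra ℝ L] {q : ℕ}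
    (J : Fin 3 → Module.End ℝ L) (g : LinearMap.BilinForm ℝ L)
    (Φ : L ≃ₗ[ℝ] (Fin q → Quaternion ℝ)) : Prop where
  map_J : ∀ α X a, Φ (J α X) a = unit α * Φ X a
  map_metric : ∀ X Y, g X Y = (∑ a, Φ X a * star (Φ Y a)).re

/-- The action of `A ∈ sp(q)` on `ℍ^q` commuting with left quaternion multiplication:
`v ↦ v A*` (on row vectors). -/
def spAct {q : ℕ} (A : sp q) (v : Fin q → Quaternion ℝ) : Fin q → Quaternion ℝ :=
  v ᵥ* (A.1)ᴴ

end HKT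

end

/-! The metric `g_r` is ad-invariant, so the zero connection is hyper-Hermitian and has torsion form
`-g(X, [Y, Z])`, which is closed by the Jacobi identity. It remains to see that Joyce's structure is
hyper-Hermitian. Recording the entries `X_ab` with `a < b` together with `X_aa + t_a` (`upper`)
turns every `J_α` into left multiplication by a unit quaternion and `g_r` into a weighted sum of
standard inner products. Integrability reduces to an identity for each middle index of the matrix
products (`joyce_nijenhuis_term`).

There are `l(l+1)/2 = n` such coordinates, so after rescaling they give an isometry `Φ` onto `ℍ^n`.
There `sp(n)` acts on the right, commuting with left multiplication and preserving the inner
product. Pulling the action back along `ι` gives `D`: it is flat because `ι` is a homomorphism, and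
nonzero because `ι` is injective.

On `T_D L`, pairing the HKT connection of `L` with `D` gives a torsion form pulled back from the
first factor, which is therefore still closed (`TangentAlgebra.isStrongHKT`). -/

noncomputable section

namespace HKT

/-! ### Strong HKT structures from ad-invariance and on tangent algebras. -/

section General

variable {L : Type*} [LieRing L] [LieAlgebra ℝ L]

/-- The torsion `3`-form of the zero connection is closed for an ad-invariant symmetric form. -/
theorem extDeriv3_neg_invariant {g : LinearMap.BilinForm ℝ L} (hs : ∀ X Y, g X Y = g Y X)
    (hg : ∀ X Y Z, g ⁅X, Y⁆ Z = g X ⁅Y, Z⁆) (X Y Z W : L) :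
    extDeriv3 (fun X Y Z => -g X ⁅Y, Z⁆) X Y Z W = 0 := by
  have h := congrArg (g X) (leibniz_lie Y Z W)
  rw [← lie_skew ⁅Y, Z⁆ W, map_add, map_neg] at h
  simp only [extDeriv3]
  -- By symmetry and invariance the six terms coincide in pairs, and their sum is twice `g X` of the
  -- Jacobi expression in `Y, Z, W`.
  rw [hs ⁅Y, Z⁆, hs ⁅Y, W⁆, hs ⁅Z, W⁆]
  simp only [hg]
  linarith

/-- A hyper-Hermitian structure with ad-invariant metric is strong HKT, with Bismut
connection zero. -/
theorem IsHyperHermitian.isStrongHKT_of_invariant {J : Fin 3 → Module.End ℝ L}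
    {g : LinearMap.BilinForm ℝ L} (h : IsHyperHermitian J g)
    (hg : ∀ X Y Z, g ⁅X, Y⁆ Z = g X ⁅Y, Z⁆) : IsStrongHKT J g := by
  have hc : torsionTensor g (0 : Connection L) = fun X Y Z => -g X ⁅Y, Z⁆ := by
    funext X Y Z
    change g X (0 - 0 - ⁅Y, Z⁆) = _
    rw [sub_zero, zero_sub, map_neg]
  refine ⟨h, 0, ⟨by simp, by simp⟩, ⟨fun X Y Z => ?_, fun X Y Z => ?_⟩, ?_⟩
  · simp only [hc]
    rw [← hg, ← hg, ← lie_skew X Y, map_neg, LinearMap.neg_apply]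
  · simp only [hc]
    rw [← lie_skew Y Z, map_neg]
  · rw [hc]
    exact extDeriv3_neg_invariant h.symm hg

namespace TangentAlgebra

variable {J : Fin 3 → Module.End ℝ L} {g : LinearMap.BilinForm ℝ L} {D : Connection L}

/-- Only integrability mixes the factors. In the second component, `DJ = 0` and `J² = -1` make the
terms cancel in pairs, with no relation needed between `D_{JX}` and `D_X`. -/
theorem isHyperHermitian (hD : IsFlat D) (h : IsHyperHermitian J g)
    (hJ : ∀ α X Y, D X (J α Y) = J α (D X Y)) :
    IsHyperHermitian (TangentAlgebra.J D hD J) (metric D hD g) where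
  hypercomplex :=
    { sq α := LinearMap.ext fun X => Prod.ext
        (LinearMap.congr_fun (h.hypercomplex.sq α) X.1)
        (LinearMap.congr_fun (h.hypercomplex.sq α) X.2)
      mul_eq := LinearMap.ext fun X => Prod.ext
        (LinearMap.congr_fun h.hypercomplex.mul_eq X.1)
        (LinearMap.congr_fun h.hypercomplex.mul_eq X.2)
      anticomm := LinearMap.ext fun X => Prod.ext
        (LinearMap.congr_fun h.hypercomplex.anticomm X.1)
        (LinearMap.congr_fun h.hypercomplex.anticomm X.2)
      integrable α X Y := by
        refine Prod.ext (h.hypercomplex.integrable α X.1 Y.1) ?_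
        have hsq (Z : L) : J α (J α Z) = -Z := LinearMap.congr_fun (h.hypercomplex.sq α) Z
        change J α ((D X.1 Y.2 - D Y.1 X.2) -
            (D (J α X.1) (J α Y.2) - D (J α Y.1) (J α X.2))) -
          ((D (J α X.1) Y.2 - D Y.1 (J α X.2)) + (D X.1 (J α Y.2) - D (J α Y.1) X.2)) = 0
        simp only [hJ, map_sub, hsq]
        abel }
  symm X Y := congrArg₂ (· + ·) (h.symm X.1 Y.1) (h.symm X.2 Y.2)
  pos X hX := by
    have hnn (Z : L) : 0 ≤ g Z Z := by
      rcases eq_or_ne Z 0 with rfl | hZ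
      · simp
      · exact (h.pos Z hZ).le
    change 0 < g X.1 X.1 + g X.2 X.2
    by_cases h1 : X.1 = 0
    · have h2 : X.2 ≠ 0 := fun h2 => hX (Prod.ext h1 h2)
      exact add_pos_of_nonneg_of_pos (hnn _) (h.pos _ h2)
    · exact add_pos_of_pos_of_nonneg (h.pos _ h1) (hnn _)
  compatible α X Y := congrArg₂ (· + ·) (h.compatible α X.1 Y.1) (h.compatible α X.2 Y.2)

/-- The connection `(X_1, X_2), (Y_1, Y_2) ↦ (B_{X_1} Y_1, D_{X_1} Y_2)` on `T_D L`. -/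
def prodConnection (D : Connection L) (hD : IsFlat D) (B : Connection L) :
    Connection (TangentAlgebra D hD) :=
  (LinearMap.mk₂ ℝ (fun X Y => (B X.1 Y.1, D X.1 Y.2))
    (fun X X' Y => by simp) (fun t X Y => by simp) (fun X Y Y' => by simp)
    (fun t X Y => by simp) : L × L →ₗ[ℝ] L × L →ₗ[ℝ] L × L)

/-- The second component of the bracket is exactly the skew-symmetrization of `D`, so the torsion
there vanishes. -/
theorem torsionTensor_prodConnection (hD : IsFlat D) (B : Connection L)
    (X Y Z : TangentAlgebra D hD) :
    torsionTensor (metric D hD g) (prodConnection D hD B) X Y Z =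
      torsionTensor g B X.1 Y.1 Z.1 := by
  change g X.1 (B Y.1 Z.1 - B Z.1 Y.1 - ⁅Y.1, Z.1⁆) +
    g X.2 (D Y.1 Z.2 - D Z.1 Y.2 - (D Y.1 Z.2 - D Z.1 Y.2)) = _
  rw [sub_self, map_zero, add_zero]
  rfl

/-- The tangent algebra of a flat hyper-Hermitian connection over a strong HKT Lie algebra is
strong HKT. -/
theorem isStrongHKT (hD : IsFlat D) (h : IsStrongHKT J g)
    (hDJ : IsHyperHermitianConnection J g D) :
    IsStrongHKT (TangentAlgebra.J D hD J) (metric D hD g) := by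
  obtain ⟨hH, B, hB, hskew, hclosed⟩ := h
  refine ⟨isHyperHermitian hD hH hDJ.parallel, prodConnection D hD B, ⟨fun X Y Z => ?_,
    fun α X Y => Prod.ext (hB.parallel α X.1 Y.1) (hDJ.parallel α X.1 Y.2)⟩,
    ⟨fun X Y Z => ?_, fun X Y Z => ?_⟩, fun X Y Z W => ?_⟩
  · change (g (B X.1 Y.1) Z.1 + g (D X.1 Y.2) Z.2) + (g Y.1 (B X.1 Z.1) + g Y.2 (D X.1 Z.2)) = 0
    linarith [hB.metric X.1 Y.1 Z.1, hDJ.metric X.1 Y.2 Z.2]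
  · simp only [torsionTensor_prodConnection]
    exact hskew.1 _ _ _
  · simp only [torsionTensor_prodConnection]
    exact hskew.2 _ _ _
  · simp only [extDeriv3, torsionTensor_prodConnection]
    exact hclosed X.1 Y.1 Z.1 W.1

end TangentAlgebra

end General

/-! ### Quaternionic matrices -/

theorem quaternion_re_sum {ι : Type*} (s : Finset ι) (f : ι → Quaternion ℝ) :
    (∑ i ∈ s, f i).re = ∑ i ∈ s, (f i).re :=
  map_sum (QuaternionAlgebra.reₗ (-1 : ℝ) 0 (-1)) f s

theorem quaternion_re_mul_comm (x y : Quaternion ℝ) : (x * y).re = (y * x).re := by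
  simp only [Quaternion.re_mul]
  ring

theorem quaternion_re_mul_star_self (x : Quaternion ℝ) :
    (x * star x).re = Quaternion.normSq x := by
  rw [Quaternion.self_mul_star, Quaternion.re_coe]

theorem re_trace_mul_comm {q : ℕ} (A B : Matrix (Fin q) (Fin q) (Quaternion ℝ)) :
    (A * B).trace.re = (B * A).trace.re := by
  simp only [Matrix.trace, Matrix.diag, Matrix.mul_apply, quaternion_re_sum]
  rw [Finset.sum_comm]
  simp only [quaternion_re_mul_comm]

theorem unit_mul_self (α : Fin 3) : unit α * unit α = -1 := by
  fin_cases α <;> ext <;>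
    simp only [Quaternion.re_mul, Quaternion.imI_mul, Quaternion.imJ_mul, Quaternion.imK_mul] <;>
    simp [unit, Quaternion.re_one, Quaternion.imI_one, Quaternion.imJ_one, Quaternion.imK_one]

theorem star_unit (α : Fin 3) : star (unit α) = -unit α := by
  fin_cases α <;> ext <;>
    simp only [Quaternion.re_star, Quaternion.imI_star, Quaternion.imJ_star, Quaternion.imK_star,
      Quaternion.re_neg, Quaternion.imI_neg, Quaternion.imJ_neg, Quaternion.imK_neg] <;>
    simp [unit]

theorem unit_zero_mul_unit_one : unit 0 * unit 1 = unit 2 := by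
  ext <;>
    simp only [Quaternion.re_mul, Quaternion.imI_mul, Quaternion.imJ_mul, Quaternion.imK_mul] <;>
    simp [unit]

theorem unit_one_mul_unit_zero : unit 1 * unit 0 = -unit 2 := by
  ext <;>
    simp only [Quaternion.re_mul, Quaternion.imI_mul, Quaternion.imJ_mul, Quaternion.imK_mul,
      Quaternion.re_neg, Quaternion.imI_neg, Quaternion.imJ_neg, Quaternion.imK_neg] <;>
    simp [unit]

theorem re_star_unit_mul (α : Fin 3) (x y : Quaternion ℝ) :
    (unit α * x * star (unit α * y)).re = (x * star y).re := by
  rw [star_mul, star_unit, quaternion_re_mul_comm]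
  simp only [mul_neg, neg_mul, ← mul_assoc]
  rw [mul_assoc (star y), unit_mul_self, quaternion_re_mul_comm x]
  simp

/-- Right multiplication and conjugate transposition each reverse products, so together they give a
left action. -/
theorem spAct_lie {q : ℕ} (A B : sp q) (v : Fin q → Quaternion ℝ) :
    spAct ⁅A, B⁆ v = spAct A (spAct B v) - spAct B (spAct A v) := by
  have h : (⁅A, B⁆ : sp q).1 = A.1 * B.1 - B.1 * A.1 := rfl
  simp only [spAct, h, Matrix.conjTranspose_sub, Matrix.conjTranspose_mul, Matrix.vecMul_sub,
    Matrix.vecMul_vecMul]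

/-- The representation `A ↦ (v ↦ v A*)` of `sp(q)` on `ℍ^q` as a bilinear map. -/
def spActₗ (q : ℕ) : sp q →ₗ[ℝ] Module.End ℝ (Fin q → Quaternion ℝ) :=
  LinearMap.mk₂ ℝ spAct
    (fun A B v => by
      simp [spAct, Matrix.conjTranspose_add, Matrix.vecMul_add])
    (fun t A v => by
      have h (a b : Fin q) : (t • A).1 a b = t • A.1 a b := rfl
      ext1 a
      simp only [spAct, Matrix.vecMul, dotProduct, Matrix.conjTranspose_apply, Pi.smul_apply, h,
        Quaternion.star_smul, mul_smul_comm, Finset.smul_sum])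
    (fun A v w => Matrix.add_vecMul _ _ _)
    (fun t A v => Matrix.smul_vecMul _ _ _)

theorem spAct_mul_left {q : ℕ} (A : sp q) (p : Quaternion ℝ) (v : Fin q → Quaternion ℝ)
    (a : Fin q) :
    spAct A (fun b => p * v b) a = p * spAct A v a := by
  simp only [spAct, Matrix.vecMul, dotProduct, Finset.mul_sum, mul_assoc]

/-- The two quaternionic sums already cancel before real parts are taken, since `A* = -A`. -/
theorem re_spAct_add {q : ℕ} (A : sp q) (v w : Fin q → Quaternion ℝ) :
    (∑ a, spAct A v a * star (w a)).re + (∑ a, v a * star (spAct A w a)).re = 0 := by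
  have h1 : ∑ a, spAct A v a * star (w a) = -∑ a, ∑ b, v b * A.1 b a * star (w a) := by
    simp only [spAct, Matrix.vecMul, dotProduct, Matrix.conjTranspose_apply, sp_apply,
      Finset.sum_mul, mul_neg, neg_mul, Finset.sum_neg_distrib]
  have h2 : ∑ a, v a * star (spAct A w a) = ∑ a, ∑ b, v a * A.1 a b * star (w b) := by
    simp only [spAct, Matrix.vecMul, dotProduct, Matrix.conjTranspose_apply, star_sum, star_mul,
      star_star, Finset.mul_sum, mul_assoc]
  rw [h1, h2, Finset.sum_comm]
  simp

theorem eq_zero_of_spAct_eq_zero {q : ℕ} {A : sp q} (h : ∀ v, spAct A v = 0) : A = 0 := by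
  have h' : (A.1)ᴴ = 0 := by
    ext1 a b
    have := congrFun (h (Pi.single a 1)) b
    rwa [spAct, Matrix.single_one_vecMul] at this
  exact Subtype.ext (Matrix.conjTranspose_eq_zero.mp h')

/-- The homomorphism `A ↦ P* A P` from `sp(l)` to `sp(n)`, for `P` with orthonormal rows. -/
def spConj {l n : ℕ} (P : Matrix (Fin l) (Fin n) (Quaternion ℝ)) (hP : P * Pᴴ = 1) :
    sp l →ₗ⁅ℝ⁆ sp n where
  toFun A := ⟨Pᴴ * A.1 * P, by
    have hA : A.1ᴴ = -A.1 := A.2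
    change (Pᴴ * A.1 * P)ᴴ = -(Pᴴ * A.1 * P)
    simp only [Matrix.conjTranspose_mul, Matrix.conjTranspose_conjTranspose, hA, Matrix.mul_assoc,
      Matrix.neg_mul, Matrix.mul_neg]⟩
  map_add' A B := Subtype.ext <| by
    change Pᴴ * (A.1 + B.1) * P = Pᴴ * A.1 * P + Pᴴ * B.1 * P
    rw [Matrix.mul_add, Matrix.add_mul]
  map_smul' t A := Subtype.ext <| by
    change Pᴴ * (t • A.1) * P = t • (Pᴴ * A.1 * P)
    rw [Matrix.mul_smul, Matrix.smul_mul]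
  map_lie' {A B} := Subtype.ext <| by
    have h (C E : Matrix (Fin l) (Fin l) (Quaternion ℝ)) :
        Pᴴ * C * P * (Pᴴ * E * P) = Pᴴ * (C * E) * P := by
      calc Pᴴ * C * P * (Pᴴ * E * P) = Pᴴ * C * (P * Pᴴ) * E * P := by
            simp only [Matrix.mul_assoc]
        _ = Pᴴ * (C * E) * P := by simp only [hP, Matrix.mul_one, Matrix.mul_assoc]
    change Pᴴ * (A.1 * B.1 - B.1 * A.1) * P =
      Pᴴ * A.1 * P * (Pᴴ * B.1 * P) - Pᴴ * B.1 * P * (Pᴴ * A.1 * P)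
    rw [h, h, Matrix.mul_sub, Matrix.sub_mul]

theorem spConj_injective {l n : ℕ} (P : Matrix (Fin l) (Fin n) (Quaternion ℝ))
    (hP : P * Pᴴ = 1) : Function.Injective (spConj P hP) := by
  have h (A : sp l) : P * (spConj P hP A).1 * Pᴴ = A.1 := by
    change P * (Pᴴ * A.1 * P) * Pᴴ = A.1
    calc P * (Pᴴ * A.1 * P) * Pᴴ = (P * Pᴴ) * A.1 * (P * Pᴴ) := by simp only [Matrix.mul_assoc]
      _ = A.1 := by rw [hP, Matrix.one_mul, Matrix.mul_one]
  intro A B hAB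
  exact Subtype.ext (by rw [← h A, ← h B, hAB])

theorem exists_sp_embedding {l n : ℕ} (h : l ≤ n) :
    ∃ ι : sp l →ₗ⁅ℝ⁆ sp n, Function.Injective ι := by
  -- With `P` the first `l` rows of the identity, `spConj` is the block inclusion padded by zeros.
  have hP : (1 : Matrix (Fin n) (Fin n) (Quaternion ℝ)).submatrix (Fin.castLE h) id *
      ((1 : Matrix (Fin n) (Fin n) (Quaternion ℝ)).submatrix (Fin.castLE h) id)ᴴ = 1 := by
    rw [Matrix.conjTranspose_submatrix, Matrix.conjTranspose_one,
      ← Matrix.submatrix_mul _ _ _ _ _ Function.bijective_id, Matrix.one_mul,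
      Matrix.submatrix_one _ (Fin.castLE_injective h)]
  exact ⟨spConj _ hP, spConj_injective _ hP⟩

/-! ### Upper triangular coordinates on `sp(l) ⊕ l u(1)` -/

theorem sp_diag_re {l : ℕ} (X : sp l) (a : Fin l) : (X.1 a a).re = 0 := by
  have h := congrArg QuaternionAlgebra.re (sp_apply X a a)
  rw [Quaternion.re_star, Quaternion.re_neg] at h
  linarith

/-- The index set of the upper triangular entries. -/
abbrev UpperIndex (l : ℕ) : Type := {p : Fin l × Fin l // p.1 ≤ p.2}

/-- The skew-Hermitian matrix with given entries above the diagonal and given imaginary parts on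
the diagonal. -/
def skewMatrix {l : ℕ} (v : UpperIndex l → Quaternion ℝ) :
    Matrix (Fin l) (Fin l) (Quaternion ℝ) :=
  fun a b => if h : a < b then v ⟨(a, b), h.le⟩
    else if h : b < a then -star (v ⟨(b, a), h.le⟩) else (v ⟨(a, a), le_rfl⟩).im

theorem skewMatrix_mem {l : ℕ} (v : UpperIndex l → Quaternion ℝ) : skewMatrix v ∈ sp l := by
  change (skewMatrix v)ᴴ = -skewMatrix v
  ext1 a b
  rw [Matrix.conjTranspose_apply, Matrix.neg_apply]
  unfold skewMatrix
  rcases lt_trichotomy a b with h | h | h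
  · simp [h, h.not_gt]
  · subst h
    simp
  · simp [h, h.not_gt]

/-- The coordinates `X_ab` for `a < b` and `X_aa + t_a` of an element `(X, t)` of
`sp(l) ⊕ l u(1)`. -/
def upper (l : ℕ) : SpU l ≃ₗ[ℝ] (UpperIndex l → Quaternion ℝ) where
  toFun X p := X.1.1 p.1.1 p.1.2 + if p.1.1 = p.1.2 then (X.2 p.1.1 : Quaternion ℝ) else 0
  map_add' X Y := by
    ext1 p
    change (X.1.1 p.1.1 p.1.2 + Y.1.1 p.1.1 p.1.2) +
      (if p.1.1 = p.1.2 then ((X.2 p.1.1 + Y.2 p.1.1 : ℝ) : Quaternion ℝ) else 0) =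
      (X.1.1 p.1.1 p.1.2 + if p.1.1 = p.1.2 then (X.2 p.1.1 : Quaternion ℝ) else 0) +
      (Y.1.1 p.1.1 p.1.2 + if p.1.1 = p.1.2 then (Y.2 p.1.1 : Quaternion ℝ) else 0)
    split_ifs
    · rw [Quaternion.coe_add, add_add_add_comm]
    · simp
  map_smul' t X := by
    ext1 p
    change t • X.1.1 p.1.1 p.1.2 +
      (if p.1.1 = p.1.2 then ((t * X.2 p.1.1 : ℝ) : Quaternion ℝ) else 0) =
      t • (X.1.1 p.1.1 p.1.2 + if p.1.1 = p.1.2 then (X.2 p.1.1 : Quaternion ℝ) else 0)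
    split_ifs
    · rw [smul_add, Quaternion.coe_mul, Quaternion.coe_mul_eq_smul]
    · simp
  invFun v := (⟨skewMatrix v, skewMatrix_mem v⟩, fun a => (v ⟨(a, a), le_rfl⟩).re)
  left_inv X := by
    refine Prod.ext (Subtype.ext ?_) ?_
    · ext1 a b
      simp only [skewMatrix]
      rcases lt_trichotomy a b with h | h | h
      · simp [h, h.ne]
      · subst h
        simp only [lt_irrefl, dite_false, if_true]
        rw [Quaternion.im_add, Quaternion.im_coe, add_zero]
        conv_rhs => rw [← Quaternion.re_add_im (X.1.1 a a), sp_diag_re]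
        simp
      · simp [h, h.ne, h.not_gt, sp_apply]
    · funext a
      simp [sp_diag_re]
  right_inv v := by
    ext1 ⟨⟨a, b⟩, h⟩
    simp only [skewMatrix]
    rcases h.lt_or_eq with h | h
    · simp only at h
      simp [h, h.ne]
    · simp only at h
      subst h
      simp only [lt_irrefl, dite_false, if_true]
      rw [add_comm, Quaternion.re_add_im]

theorem upper_of_lt {l : ℕ} (X : SpU l) {a b : Fin l} (h : a < b) :
    upper l X ⟨(a, b), h.le⟩ = X.1.1 a b := by
  simp [upper, h.ne]

theorem upper_diag {l : ℕ} (X : SpU l) (a : Fin l) :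
    upper l X ⟨(a, a), le_rfl⟩ = X.1.1 a a + (X.2 a : Quaternion ℝ) := by
  simp [upper]

section JoyceEntries

variable {l : ℕ} (q : Quaternion ℝ) (X : SpU l)

theorem joyceEnd_of_lt {a b : Fin l} (h : a < b) :
    (joyceEnd l q X).1.1 a b = q * X.1.1 a b := by
  change joyceMatrix q X a b = _
  simp [joyceMatrix, h]

/-- Entries below the diagonal are minus conjugates of those above, which turns left multiplication
into right multiplication by the conjugate. -/
theorem joyceEnd_of_gt {a b : Fin l} (h : b < a) :
    (joyceEnd l q X).1.1 a b = X.1.1 a b * star q := by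
  change joyceMatrix q X a b = _
  simp only [joyceMatrix, h, h.not_gt, if_true, if_false]
  rw [star_mul, sp_apply, neg_mul, neg_neg]

/-- The new torus coordinate is left unevaluated: the integrability computation needs only that it
is a real scalar, hence central. -/
theorem joyceEnd_diag (a : Fin l) :
    (joyceEnd l q X).1.1 a a =
      q * (X.1.1 a a + (X.2 a : Quaternion ℝ)) - ((joyceEnd l q X).2 a : Quaternion ℝ) := by
  change joyceMatrix q X a a = q * (X.1.1 a a + (X.2 a : Quaternion ℝ)) -
    ((q * (X.1.1 a a + (X.2 a : Quaternion ℝ))).re : Quaternion ℝ)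
  simp only [joyceMatrix, lt_irrefl, if_false]
  rw [eq_sub_iff_add_eq, add_comm, Quaternion.re_add_im]

theorem upper_joyceEnd (p : UpperIndex l) : upper l (joyceEnd l q X) p = q * upper l X p := by
  obtain ⟨⟨a, b⟩, h⟩ := p
  rcases (show a ≤ b from h).lt_or_eq with h | rfl
  · rw [upper_of_lt _ h, upper_of_lt _ h, joyceEnd_of_lt _ _ h]
  · rw [upper_diag, upper_diag, joyceEnd_diag, sub_add_cancel]

end JoyceEntries

/-! ### Integrability of Joyce's structure. -/

theorem spU_lie_fst {l : ℕ} (X Y : SpU l) :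
    (⁅X, Y⁆ : SpU l).1.1 = X.1.1 * Y.1.1 - Y.1.1 * X.1.1 := rfl

theorem spU_lie_snd {l : ℕ} (X Y : SpU l) : (⁅X, Y⁆ : SpU l).2 = 0 := by
  funext a
  change X.2 a * Y.2 a - Y.2 a * X.2 a = 0
  ring

theorem upper_bracket {l : ℕ} (X Y : SpU l) (p : UpperIndex l) :
    upper l ⁅X, Y⁆ p = ∑ c, (X.1.1 p.1.1 c * Y.1.1 c p.1.2 - Y.1.1 p.1.1 c * X.1.1 c p.1.2) := by
  change (⁅X, Y⁆ : SpU l).1.1 p.1.1 p.1.2 +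
    (if p.1.1 = p.1.2 then ((⁅X, Y⁆ : SpU l).2 p.1.1 : Quaternion ℝ) else 0) = _
  rw [spU_lie_fst, spU_lie_snd]
  simp [Matrix.mul_apply, Finset.sum_sub_distrib]

/-- The summand with middle index `c` in the Nijenhuis tensor of Joyce's structure. -/
theorem joyce_nijenhuis_term {l : ℕ} (α : Fin 3) (X Y : SpU l) {a b : Fin l} (hab : a ≤ b)
    (c : Fin l) :
    unit α * ((X.1.1 a c * Y.1.1 c b - Y.1.1 a c * X.1.1 c b) -
      ((joyceJ l α X).1.1 a c * (joyceJ l α Y).1.1 c b -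
        (joyceJ l α Y).1.1 a c * (joyceJ l α X).1.1 c b)) -
    (((joyceJ l α X).1.1 a c * Y.1.1 c b - Y.1.1 a c * (joyceJ l α X).1.1 c b) +
      (X.1.1 a c * (joyceJ l α Y).1.1 c b - (joyceJ l α Y).1.1 a c * X.1.1 c b)) = 0 := by
  have hp : unit α * unit α = -1 := unit_mul_self α
  have hp' (z : Quaternion ℝ) : unit α * (unit α * z) = -z := by rw [← mul_assoc, hp, neg_one_mul]
  have hs (t : ℝ) : (t : Quaternion ℝ) = t • 1 := Algebra.algebraMap_eq_smul_one t
  unfold joyceJ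
  -- Write `u` for the unit. If `a < c`, the left factor is multiplied by `u` on the left, and `u² =
  -- -1` gives cancellation whatever the right factor is. If `c < a`, then `c < b`, and the left
  -- factor acquires `-u` on its right while the right factor acquires `u` on its left, so `(-u)u =
  -- 1` between them.
  rcases lt_trichotomy a c with hac | rfl | hca
  · rcases lt_trichotomy c b with hcb | rfl | hbc
    · simp only [joyceEnd_of_lt _ _ hac, joyceEnd_of_lt _ _ hcb]
      simp only [mul_sub, mul_assoc, hp']
      abel
    · simp only [joyceEnd_of_lt _ _ hac, joyceEnd_diag]
      generalize (joyceEnd l (unit α) X).2 c = s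
      generalize (joyceEnd l (unit α) Y).2 c = t
      simp only [mul_sub, mul_add, mul_assoc, hp', hs, mul_smul_comm, mul_one]
      module
    · simp only [joyceEnd_of_lt _ _ hac, joyceEnd_of_gt _ _ hbc, star_unit]
      simp only [mul_sub, mul_assoc, hp', mul_neg]
      abel
  · rcases hab.lt_or_eq with hab | rfl
    · simp only [joyceEnd_of_lt _ _ hab, joyceEnd_diag]
      generalize (joyceEnd l (unit α) X).2 a = s
      generalize (joyceEnd l (unit α) Y).2 a = t
      simp only [mul_sub, sub_mul, mul_add, add_mul, mul_assoc, hp', hs, mul_smul_comm,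
        smul_mul_assoc, mul_neg, one_mul, mul_one]
      module
    -- Only for `a = b = c` do the `XY` and `YX` halves fail to vanish separately: each leaves a
    -- remainder in the torus coordinates that is symmetric in `X, Y`, and the remainders cancel.
    · simp only [joyceEnd_diag]
      generalize (joyceEnd l (unit α) X).2 a = s
      generalize (joyceEnd l (unit α) Y).2 a = t
      simp only [mul_sub, sub_mul, mul_add, add_mul, mul_assoc, hp', hp, hs, mul_smul_comm,
        smul_mul_assoc, mul_neg, one_mul, mul_one]
      module
  · have hcb := hca.trans_le hab
    simp only [joyceEnd_of_gt _ _ hca, joyceEnd_of_lt _ _ hcb, star_unit]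
    simp only [mul_sub, mul_assoc, hp', mul_neg, neg_mul]
    abel

theorem isHypercomplex_joyceJ (l : ℕ) : IsHypercomplex (joyceJ l) where
  sq α := by
    refine LinearMap.ext fun X => (upper l).injective (funext fun p => ?_)
    simp only [joyceJ, Module.End.mul_apply, upper_joyceEnd]
    rw [← mul_assoc, unit_mul_self]
    simp
  mul_eq := by
    refine LinearMap.ext fun X => (upper l).injective (funext fun p => ?_)
    simp only [joyceJ, Module.End.mul_apply, upper_joyceEnd]
    rw [← mul_assoc, unit_zero_mul_unit_one]
  anticomm := by
    refine LinearMap.ext fun X => (upper l).injective (funext fun p => ?_)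
    simp only [joyceJ, Module.End.mul_apply, upper_joyceEnd, LinearMap.neg_apply, map_neg,
      Pi.neg_apply]
    rw [← mul_assoc, ← mul_assoc, unit_zero_mul_unit_one, unit_one_mul_unit_zero, neg_mul, neg_neg]
  integrable α X Y := by
    refine (upper l).injective (funext fun p => ?_)
    have hJ (Z : SpU l) : upper l (joyceJ l α Z) p = unit α * upper l Z p :=
      upper_joyceEnd _ _ _
    simp only [nijenhuis, map_sub, map_add, map_zero, Pi.sub_apply, Pi.add_apply, hJ,
      upper_bracket]
    rw [← mul_sub, ← Finset.sum_sub_distrib, Finset.mul_sum, ← Finset.sum_add_distrib,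
      ← Finset.sum_sub_distrib]
    exact Finset.sum_eq_zero fun c _ => joyce_nijenhuis_term α X Y p.2 c

/-! ### The metric in upper triangular coordinates. -/

/-- The multiplicity of an upper triangular entry in the trace form. -/
def upperWeight {l : ℕ} (p : UpperIndex l) : ℝ := if p.1.1 = p.1.2 then 1 else 2

theorem upperWeight_pos {l : ℕ} (p : UpperIndex l) : 0 < upperWeight p := by
  unfold upperWeight
  split_ifs <;> norm_num

theorem sum_eq_sum_upperWeight {l : ℕ} (F : Fin l → Fin l → ℝ) (hF : ∀ a b, F a b = F b a) :
    ∑ a, ∑ b, F a b = ∑ p : UpperIndex l, upperWeight p * F p.1.1 p.1.2 := by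
  -- `G` is the weighted upper triangle of `F`; both have the same symmetrization, hence the same
  -- total.
  let G (a b : Fin l) : ℝ := if a ≤ b then (if a = b then 1 else 2) * F a b else 0
  have hG : ∑ p : UpperIndex l, upperWeight p * F p.1.1 p.1.2 = ∑ a, ∑ b, G a b := by
    rw [← Fintype.sum_prod_type', ← Finset.sum_filter]
    exact (Finset.sum_subtype _ (by simp)
      fun p : Fin l × Fin l => (if p.1 = p.2 then 1 else 2) * F p.1 p.2).symm
  have hsymm : ∑ a, ∑ b, (F a b + F b a) = ∑ a, ∑ b, (G a b + G b a) := by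
    refine Finset.sum_congr rfl fun a _ => Finset.sum_congr rfl fun b _ => ?_
    rcases lt_trichotomy a b with h | h | h
    · simp [G, h.le, h.ne, h.not_ge, hF b a, two_mul]
    · simp [G, h]
    · simp [G, h.le, h.ne, h.not_ge, hF b a, two_mul]
  have hswap (H : Fin l → Fin l → ℝ) : ∑ a, ∑ b, (H a b + H b a) = 2 * ∑ a, ∑ b, H a b := by
    simp only [Finset.sum_add_distrib]
    rw [Finset.sum_comm (f := fun a b => H b a), two_mul]
  rw [hswap, hswap] at hsymm
  linarith

/-- Skew-Hermitian symmetry makes the `(a, b)` and `(b, a)` terms of the trace equal. On the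
diagonal, the cross terms between `X_aa` and the torus are purely imaginary. Positivity and
compatibility with `J_α` are read off from this form. -/
theorem joyceMetric_eq_sum_upper (l : ℕ) (r : ℝ) (X Y : SpU l) :
    joyceMetric l r X Y =
      r * ∑ p, upperWeight p * (upper l X p * star (upper l Y p)).re := by
  let F (a b : Fin l) : ℝ :=
    (X.1.1 a b * star (Y.1.1 a b)).re + if a = b then X.2 a * Y.2 a else 0
  have hF (a b : Fin l) : F a b = F b a := by
    have h : (X.1.1 a b * star (Y.1.1 a b)).re = (X.1.1 b a * star (Y.1.1 b a)).re := by
      rw [← neg_eq_iff_eq_neg.mpr (sp_apply X.1 a b), ← neg_eq_iff_eq_neg.mpr (sp_apply Y.1 a b),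
        star_neg, star_star, neg_mul_neg, ← Quaternion.re_star, star_mul, star_star,
        quaternion_re_mul_comm]
    rcases eq_or_ne a b with rfl | hab
    · rfl
    · simp only [F, h, hab, hab.symm, if_false]
  have hFu (p : UpperIndex l) : (upper l X p * star (upper l Y p)).re = F p.1.1 p.1.2 := by
    obtain ⟨⟨a, b⟩, h⟩ := p
    rcases (show a ≤ b from h).lt_or_eq with h | rfl
    · rw [upper_of_lt _ h, upper_of_lt _ h]
      simp [F, h.ne]
    · rw [upper_diag, upper_diag]
      simp only [F, if_true, star_add, Quaternion.star_coe, add_mul, mul_add, Quaternion.re_add,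
        Quaternion.coe_mul_eq_smul, Quaternion.mul_coe_eq_smul, Quaternion.re_smul,
        Quaternion.re_star, Quaternion.re_coe, sp_diag_re, smul_eq_mul]
      ring
  simp only [hFu]
  rw [← sum_eq_sum_upperWeight F hF]
  simp only [joyceMetric, LinearMap.mk₂_apply, F, Finset.sum_add_distrib, Finset.sum_ite_eq,
    Finset.mem_univ, if_true, Matrix.trace, Matrix.diag, Matrix.mul_apply, quaternion_re_sum,
    sp_apply, ← Finset.sum_neg_distrib, mul_neg, Quaternion.re_neg]

/-- The quaternionic trace is not cyclic, but its real part is; the torus contributes nothing to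
brackets. -/
theorem joyceMetric_invariant (l : ℕ) (r : ℝ) (X Y Z : SpU l) :
    joyceMetric l r ⁅X, Y⁆ Z = joyceMetric l r X ⁅Y, Z⁆ := by
  have h : (Y.1.1 * (X.1.1 * Z.1.1)).trace.re = (X.1.1 * (Z.1.1 * Y.1.1)).trace.re := by
    rw [re_trace_mul_comm, Matrix.mul_assoc]
  simp only [joyceMetric, LinearMap.mk₂_apply, spU_lie_fst, spU_lie_snd, Matrix.sub_mul,
    Matrix.mul_sub, Matrix.trace_sub, Quaternion.re_sub, Matrix.mul_assoc, h]
  simp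

theorem isHyperHermitian_joyce (l : ℕ) {r : ℝ} (hr : 0 < r) :
    IsHyperHermitian (joyceJ l) (joyceMetric l r) where
  hypercomplex := isHypercomplex_joyceJ l
  symm X Y := by
    simp only [joyceMetric, LinearMap.mk₂_apply]
    rw [re_trace_mul_comm]
    simp only [mul_comm]
  pos X hX := by
    rw [joyceMetric_eq_sum_upper]
    have hX' : upper l X ≠ 0 := (LinearEquiv.map_ne_zero_iff _).mpr hX
    obtain ⟨p, hp⟩ := Function.ne_iff.mp hX'
    simp only [quaternion_re_mul_star_self]
    refine mul_pos hr (Finset.sum_pos' (fun p _ => ?_) ⟨p, Finset.mem_univ p, ?_⟩)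
    · exact mul_nonneg (upperWeight_pos p).le Quaternion.normSq_nonneg
    · exact mul_pos (upperWeight_pos p)
        (Quaternion.normSq_nonneg.lt_of_ne' (Quaternion.normSq_ne_zero.mpr hp))
  compatible α X Y := by
    simp only [joyceMetric_eq_sum_upper, joyceJ, upper_joyceEnd, re_star_unit_mul]

theorem isStrongHKT_joyce (l : ℕ) {r : ℝ} (hr : 0 < r) :
    IsStrongHKT (joyceJ l) (joyceMetric l r) :=
  (isHyperHermitian_joyce l hr).isStrongHKT_of_invariant (joyceMetric_invariant l r)

/-- Sorted pairs correspond to unordered pairs with repetition. -/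
theorem card_upperIndex (l : ℕ) : Fintype.card (UpperIndex l) = l * (l + 1) / 2 := by
  rw [← Fintype.card_congr (Sym2.sortEquiv (α := Fin l)), Sym2.card, Fintype.card_fin,
    Nat.choose_two_right, Nat.add_sub_cancel, mul_comm]

/-- Scaling of coordinates by nonzero reals. -/
def scaleEquiv {ι V : Type*} [AddCommGroup V] [Module ℝ V] (w : ι → ℝ) (hw : ∀ i, w i ≠ 0) :
    (ι → V) ≃ₗ[ℝ] (ι → V) :=
  LinearEquiv.piCongrRight fun i => LinearEquiv.smulOfNeZero ℝ V (w i) (hw i)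

theorem exists_quaternionicIsometry_joyce (l : ℕ) {r : ℝ} (hr : 0 < r) :
    ∃ Φ : SpU l ≃ₗ[ℝ] (Fin (l * (l + 1) / 2) → Quaternion ℝ),
      IsQuaternionicIsometry (joyceJ l) (joyceMetric l r) Φ := by
  have hw (p : UpperIndex l) : 0 < r * upperWeight p := mul_pos hr (upperWeight_pos p)
  let e := Fintype.equivFinOfCardEq (card_upperIndex l)
  -- The square roots absorb the weights of the metric; being real, they commute with left
  -- quaternion multiplication.
  let Φ := (upper l).trans ((scaleEquiv (fun p => √(r * upperWeight p))
    fun p => (Real.sqrt_pos.mpr (hw p)).ne').trans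
    (LinearEquiv.funCongrLeft ℝ (Quaternion ℝ) e.symm))
  have hΦ (X : SpU l) (i : Fin (l * (l + 1) / 2)) :
      Φ X i = √(r * upperWeight (e.symm i)) • upper l X (e.symm i) := rfl
  refine ⟨Φ, fun α X i => ?_, fun X Y => ?_⟩
  · rw [hΦ, hΦ, joyceJ, upper_joyceEnd, mul_smul_comm]
  · simp only [hΦ, joyceMetric_eq_sum_upper, quaternion_re_sum, Finset.mul_sum]
    rw [← Equiv.sum_comp e.symm]
    refine Finset.sum_congr rfl fun i _ => ?_
    rw [Quaternion.star_smul, smul_mul_smul_comm, Real.mul_self_sqrt (hw _).le,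
      Quaternion.re_smul, smul_eq_mul, mul_assoc]

/-! ### Flat hyper-Hermitian connections from homomorphisms into `sp(q)`. -/

section PullBack

variable {L : Type*} [LieRing L] [LieAlgebra ℝ L] {q : ℕ}

/-- The connection on `L ≅ ℍ^q` induced by a homomorphism `L → sp(q)`. -/
def inducedConnection (Φ : L ≃ₗ[ℝ] (Fin q → Quaternion ℝ)) (ρ : L →ₗ⁅ℝ⁆ sp q) : Connection L :=
  Φ.symm.conj.toLinearMap ∘ₗ spActₗ q ∘ₗ (ρ : L →ₗ[ℝ] sp q)

theorem map_inducedConnection (Φ : L ≃ₗ[ℝ] (Fin q → Quaternion ℝ)) (ρ : L →ₗ⁅ℝ⁆ sp q)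
    (X Y : L) : Φ (inducedConnection Φ ρ X Y) = spAct (ρ X) (Φ Y) :=
  Φ.apply_symm_apply _

theorem isFlat_inducedConnection (Φ : L ≃ₗ[ℝ] (Fin q → Quaternion ℝ)) (ρ : L →ₗ⁅ℝ⁆ sp q) :
    IsFlat (inducedConnection Φ ρ) := by
  refine fun X Y => LinearMap.ext fun Z => Φ.injective ?_
  simp only [curvature, LinearMap.sub_apply, Module.End.mul_apply, map_sub, map_inducedConnection,
    LieHom.map_lie, spAct_lie, sub_self, LinearMap.zero_apply, map_zero]

theorem isHyperHermitianConnection_inducedConnection {J : Fin 3 → Module.End ℝ L}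
    {g : LinearMap.BilinForm ℝ L} {Φ : L ≃ₗ[ℝ] (Fin q → Quaternion ℝ)}
    (hΦ : IsQuaternionicIsometry J g Φ) (ρ : L →ₗ⁅ℝ⁆ sp q) :
    IsHyperHermitianConnection J g (inducedConnection Φ ρ) where
  metric X Y Z := by
    simp only [hΦ.map_metric, map_inducedConnection, re_spAct_add]
  parallel α X Y := by
    refine Φ.injective (funext fun a => ?_)
    rw [hΦ.map_J, map_inducedConnection, map_inducedConnection, ← spAct_mul_left]
    congr 1
    exact funext fun b => hΦ.map_J α Y b

theorem inducedConnection_ne_zero (Φ : L ≃ₗ[ℝ] (Fin q → Quaternion ℝ)) {ρ : L →ₗ⁅ℝ⁆ sp q}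
    {X : L} (hX : ρ X ≠ 0) : inducedConnection Φ ρ ≠ 0 := by
  refine fun h => hX (eq_zero_of_spAct_eq_zero fun v => ?_)
  rw [← Φ.apply_symm_apply v, ← map_inducedConnection, h]
  simp

end PullBack

theorem exists_sp_ne_zero {l : ℕ} (hl : 1 ≤ l) : ∃ X : sp l, X ≠ 0 := by
  let a : Fin l := ⟨0, hl⟩
  refine ⟨⟨skewMatrix fun _ => unit 0, skewMatrix_mem _⟩, fun h => ?_⟩
  have h' : skewMatrix (fun _ => unit 0) a a = 0 := congrFun (congrFun (congrArg Subtype.val h) a) a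
  have h'' : (unit 0).im.imI = 0 := by
    simp only [skewMatrix, lt_irrefl, dite_false] at h'
    rw [h']
    rfl
  exact one_ne_zero h''

end HKT

end

theorem proposition5p1 (l : ℕ) (hl : 1 ≤ l) (r : ℝ) (hr : 0 < r) :
    HKT.IsStrongHKT (HKT.joyceJ l) (HKT.joyceMetric l r) ∧
    (∃ ι : HKT.sp l →ₗ⁅ℝ⁆ HKT.sp (l * (l + 1) / 2), Function.Injective ι) ∧
    ∀ ι : HKT.sp l →ₗ⁅ℝ⁆ HKT.sp (l * (l + 1) / 2), Function.Injective ι →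
      ∃ (D : HKT.Connection (HKT.SpU l)) (hD : HKT.IsFlat D),
        D ≠ 0 ∧
        HKT.IsHyperHermitianConnection (HKT.joyceJ l) (HKT.joyceMetric l r) D ∧
        (∃ Φ : HKT.SpU l ≃ₗ[ℝ] (Fin (l * (l + 1) / 2) → Quaternion ℝ),
          HKT.IsQuaternionicIsometry (HKT.joyceJ l) (HKT.joyceMetric l r) Φ ∧
          ∀ X Y : HKT.SpU l, Φ (D X Y) = HKT.spAct (ι X.1) (Φ Y)) ∧
        HKT.IsStrongHKT (HKT.TangentAlgebra.J D hD (HKT.joyceJ l))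
          (HKT.TangentAlgebra.metric D hD (HKT.joyceMetric l r)) := by
  -- The block inclusion needs `l ≤ n`, which amounts to `2 ≤ l + 1` after clearing the factor `l`.
  have hln : l ≤ l * (l + 1) / 2 := by
    rw [Nat.le_div_iff_mul_le two_pos]
    exact Nat.mul_le_mul_left l (by omega)
  refine ⟨HKT.isStrongHKT_joyce l hr, HKT.exists_sp_embedding hln, fun ι hι => ?_⟩
  obtain ⟨Φ, hΦ⟩ := HKT.exists_quaternionicIsometry_joyce l hr
  obtain ⟨X, hX⟩ := HKT.exists_sp_ne_zero hl
  -- The abelian summand acts trivially, so `D` depends only on the `sp(l)` component of its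
  -- direction.
  let ρ : HKT.SpU l →ₗ⁅ℝ⁆ HKT.sp (l * (l + 1) / 2) :=
    ι.comp { LinearMap.fst ℝ (HKT.sp l) (Fin l → ℝ) with map_lie' := rfl }
  have hρ : ρ (X, 0) ≠ 0 := fun h => hX (hι (h.trans (map_zero ι).symm))
  have hH := HKT.isHyperHermitianConnection_inducedConnection hΦ ρ
  exact ⟨HKT.inducedConnection Φ ρ, HKT.isFlat_inducedConnection Φ ρ,
    HKT.inducedConnection_ne_zero Φ hρ, hH, ⟨Φ, hΦ, HKT.map_inducedConnection Φ ρ⟩,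
    HKT.TangentAlgebra.isStrongHKT _ (HKT.isStrongHKT_joyce l hr) hH⟩
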